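/- For a DAG $\mathcal D$ on a finite vertex set, a path of its skeleton is active given a vertex set $S$ if every collider on it belongs to $S$ or has a descendant in $S$, and no other interior vertex belongs to $S$; two vertex sets are d-separated by $S$ if no path between them is active given $S$. Two DAGs on the same vertices are Markov equivalent if they encode the same conditional independencies, i.e. if the same disjoint sets $A,B$ are d-separated by the same sets $S$ (with $A,B,S$ pairwise disjoint). The essential graph of $\mathcal D$ has the same skeleton as $\mathcal D$, and an edge is directed in it if and only if it has the same orientation in all DAGs Markov equivalent to $\mathcal D$; for a graph $\mathcal C$, $\mathrm{Size}(\mathcal C)$ is the number of DAGs whose essential graph is $\mathcal C$. Let $\mathcal K$ be a finite undirected chordal graph (every cycle with at least four vertices has a chord). For each integer $m\ge 0$ let $\mathcal K^{m+}$ be the graph obtained from $\mathcal K$ by adding $m$ dominating vertices, adjacent to each other and to all vertices of $\mathcal K$, and put $f(\mathcal K,m)=\mathrm{Size}(\mathcal K^{m+})$. Then $f(\mathcal K,m)$ is a polynomial in $m$ multiplied by $m!$: there is a polynomial $q$ with rational coefficients, depending only on $\mathcal K$, such that $$f(\mathcal K,m)=m!\,q(m)\qquad\text{for every integer } m\ge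 0,$$ and $m!$ divides $f(\mathcal K,m)$ for every $m\ge 0$, i.e. all values $q(m)$ are integers. -/

import Mathlib

open scoped Nat

/-! ## Chordal graphs and extended graphs -/

/-- An undirected graph is chordal if every cycle with four or more vertices has a chord, that is,
an edge of the graph joining two vertices of the cycle that are not adjacent in the cycle. -/
def IsChordalGraph {V : Type*} (G : SimpleGraph V) : Prop :=
  ∀ (v : V) (c : G.Walk v v), c.IsCycle → 4 ≤ c.length →
    ∃ x ∈ c.support, ∃ y ∈ c.support, G.Adj x y ∧ s(x, y) ∉ c.edges

/-- The extended graph of `K`, obtained by adding `m` dominating vertices to `K`: the added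
vertices are adjacent to each other and to all the vertices of `K`. -/
def extendedGraph {V : Type*} (K : SimpleGraph V) (m : ℕ) : SimpleGraph (V ⊕ Fin m) :=
  (K ⊕g (⊤ : SimpleGraph (Fin m))) ⊔ completeBipartiteGraph V (Fin m)

/-! ## Directed acyclic graphs, d-separation and Markov equivalence -/

/-- A directed acyclic graph: a digraph without directed cycles. -/
@[ext]
structure DAG (V : Type*) extends Digraph V where
  acyclic : ∀ v, ¬ Relation.TransGen Adj v v

namespace DAG

variable {V : Type*}

/-- The skeleton of a DAG: the undirected graph obtained by forgetting the directions. -/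
def skeleton (D : DAG V) : SimpleGraph V := SimpleGraph.fromRel D.Adj

/-- The `i`-th vertex of the path `p` is a collider on `p`: both edges of `p` at this
vertex are directed into it. Only used for interior vertices, `0 < i < p.length`. -/
def IsCollider (D : DAG V) {a b : V} (p : D.skeleton.Walk a b) (i : ℕ) : Prop :=
  D.Adj (p.getVert (i - 1)) (p.getVert i) ∧ D.Adj (p.getVert (i + 1)) (p.getVert i)

/-- The path `p` is active (not blocked) given `S`: each collider on `p` is in `S` or has a
descendant in `S`, and no interior vertex of `p` which is not a collider is in `S`. -/
def IsActive (D : DAG V) {a b : V} (p : D.skeleton.Walk a b) (S : Set V) : Prop :=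
  ∀ i, 0 < i → i < p.length →
    (D.IsCollider p i → ∃ s ∈ S, Relation.ReflTransGen D.Adj (p.getVert i) s) ∧
    (¬ D.IsCollider p i → p.getVert i ∉ S)

/-- `S` d-separates `A` from `B`: every path of the skeleton from a vertex of `A` to a vertex
of `B` is blocked by `S`. -/
def DSeparates (D : DAG V) (A B S : Set V) : Prop :=
  ∀ a ∈ A, ∀ b ∈ B, ∀ p : D.skeleton.Walk a b, p.IsPath → ¬ D.IsActive p S

/-- Two DAGs on the same vertices are Markov equivalent if they encode the same conditional
independencies `A ⫫ B | S`, for `A`, `B`, `S` pairwise disjoint sets of vertices. -/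
def MarkovEquivalent (D D' : DAG V) : Prop :=
  ∀ A B S : Set V, Disjoint A B → Disjoint A S → Disjoint B S →
    (D.DSeparates A B S ↔ D'.DSeparates A B S)

end DAG

instance DAG.finite {V : Type*} [Finite V] : Finite (DAG V) :=
  Finite.of_injective (fun D : DAG V => D.Adj) fun _ _ h => DAG.ext h

/-! ## Essential graphs and sizes of Markov equivalence classes -/

/-- A graph that may have both undirected and directed edges. -/
@[ext]
structure MixedGraph (V : Type*) where
  /-- `Line a b`: there is an undirected edge between `a` and `b`. -/
  Line : V → V → Prop
  /-- `Arrow a b`: there is a directed edge from `a` to `b`. -/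
  Arrow : V → V → Prop

/-- An undirected graph, seen as a mixed graph without directed edges. -/
def SimpleGraph.toMixedGraph {V : Type*} (U : SimpleGraph V) : MixedGraph V where
  Line := U.Adj
  Arrow := fun _ _ => False

/-- The essential graph of (the Markov equivalence class of) a DAG: it has the same skeleton, and
an edge is directed if and only if it has the same orientation in every equivalent DAG. -/
def DAG.essentialGraph {V : Type*} (D : DAG V) : MixedGraph V where
  Arrow := fun a b => ∀ D' : DAG V, D.MarkovEquivalent D' → D'.Adj a b
  Line := fun a b => D.skeleton.Adj a b ∧
    (¬ ∀ D' : DAG V, D.MarkovEquivalent D' → D'.Adj a b) ∧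
    (¬ ∀ D' : DAG V, D.MarkovEquivalent D' → D'.Adj b a)

/-- The Markov equivalence class represented by `C`: all DAGs whose essential graph is `C`. -/
def MixedGraph.markovClass {V : Type*} (C : MixedGraph V) : Set (DAG V) :=
  {D | D.essentialGraph = C}

/-- The size of (the Markov equivalence class represented by) `C`. -/
noncomputable def MixedGraph.size {V : Type*} (C : MixedGraph V) : ℕ :=
  C.markovClass.ncard

/-- `f(K, m)`: the size of the Markov equivalence class represented by the graph obtained by
adding `m` dominating vertices to `K`. -/
noncomputable def sizeFormula {V : Type*} (K : SimpleGraph V) (m : ℕ) : ℕ :=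
  (extendedGraph K m).toMixedGraph.size

/-! A DAG has an essential graph without arrows exactly when it is moral. A v-structure is visible
to d-separation, so it would force arrows (`MarkovEquivalent.adj_of_vStructure`). For moral DAGs
d-separation is plain separation in the skeleton (`IsMoral.dSeparates_iff`), and any edge can be
reversed within the class (`IsMoral.exists_adj_symm`). So the size counts moral acyclic
orientations.

In such an orientation of the extended graph the dominating vertices are linearly ordered, and each
vertex of `K` is adjacent to all of them, so it has a definite position among them. The vertices of
`K` before the last dominating vertex are its parents, hence a clique. The order is independent of
the remaining data, which gives the factor `m !` (`sizeFormula_eq`).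

The cofactor is a sum over pairs `(D, C)`, with `D` a moral orientation of `K` and `C` a
parent-closed clique, the vertices not in last position. `D` orders `C` linearly, so the positions
are a weakly increasing sequence in `Fin m`: `m.multichoose |C|` choices, a polynomial in `m`. The
set of pairs does not depend on `m`. -/

/-! ## d-separation in moral DAGs -/

/-- The graph obtained from `G` by removing all edges that meet `S`. -/
def SimpleGraph.avoiding {V : Type*} (G : SimpleGraph V) (S : Set V) : SimpleGraph V where
  Adj x y := G.Adj x y ∧ x ∉ S ∧ y ∉ S
  symm := ⟨fun _ _ h => ⟨h.1.symm, h.2.2, h.2.1⟩⟩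
  loopless := ⟨fun _ h => h.1.ne rfl⟩

theorem SimpleGraph.avoiding_le {V : Type*} (G : SimpleGraph V) (S : Set V) :
    G.avoiding S ≤ G := fun _ _ h => h.1

namespace DAG

variable {V : Type*}

theorem not_adj_self (D : DAG V) (a : V) : ¬ D.Adj a a :=
  fun h => D.acyclic a (.single h)

theorem adj_asymm (D : DAG V) {a b : V} (h : D.Adj a b) : ¬ D.Adj b a :=
  fun h' => D.acyclic a (.tail (.single h) h')

theorem skeleton_adj (D : DAG V) {a b : V} :
    D.skeleton.Adj a b ↔ D.Adj a b ∨ D.Adj b a := by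
  rw [skeleton, SimpleGraph.fromRel_adj]
  refine ⟨fun h => h.2, fun h => ⟨?_, h⟩⟩
  rintro rfl
  exact D.not_adj_self a (h.elim id id)

/-- A DAG is moral if any two parents of a vertex are adjacent. -/
def IsMoral (D : DAG V) : Prop :=
  ∀ ⦃a b c : V⦄, D.Adj a c → D.Adj b c → a ≠ b → D.skeleton.Adj a b

/-- Only colliders of an active path can lie in `S`. The two path neighbours of a collider are
non-colliders and, by morality, adjacent, so each collider can be bypassed. -/
theorem IsMoral.reachable_of_isActive {D : DAG V} (hD : D.IsMoral) {S : Set V} {a b : V}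
    (ha : a ∉ S) (hb : b ∉ S) (p : D.skeleton.Walk a b) (hp : p.IsPath) (h : D.IsActive p S) :
    (D.skeleton.avoiding S).Reachable a b := by
  have hS : ∀ j ≤ p.length, (j = 0 ∨ j = p.length ∨ ¬ D.IsCollider p j) → p.getVert j ∉ S := by
    intro j hj hj'
    rcases Nat.eq_zero_or_pos j with rfl | h0
    · simpa using ha
    rcases hj.eq_or_lt with rfl | h1
    · simpa using hb
    · exact (h j h0 h1).2 (by rcases hj' with h | h | h <;> first | exact h | omega)
  have key : ∀ j ≤ p.length, (j = 0 ∨ j = p.length ∨ ¬ D.IsCollider p j) →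
      (D.skeleton.avoiding S).Reachable a (p.getVert j) := by
    intro j
    induction j using Nat.strong_induction_on with
    | _ j ih =>
      intro hj hj'
      rcases j with _ | j
      · simp
      by_cases hc : j = 0 ∨ ¬ D.IsCollider p j
      · have hc' : j = 0 ∨ j = p.length ∨ ¬ D.IsCollider p j := by tauto
        refine (ih j (by omega) (by omega) hc').trans (SimpleGraph.Adj.reachable ?_)
        exact ⟨p.adj_getVert_succ (by omega), hS j (by omega) hc', hS _ hj hj'⟩
      · push Not at hc
        obtain ⟨i, rfl⟩ : ∃ i, j = i + 1 := ⟨j - 1, by omega⟩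
        obtain ⟨h1, h2⟩ := hc.2
        simp only [Nat.add_sub_cancel] at h1
        have hc' : i = 0 ∨ i = p.length ∨ ¬ D.IsCollider p i :=
          .inr (.inr fun hi => D.adj_asymm h1 hi.2)
        refine (ih i (by omega) (by omega) hc').trans (SimpleGraph.Adj.reachable ?_)
        refine ⟨hD h1 h2 fun he => ?_, hS i (by omega) hc', hS _ hj hj'⟩
        have := hp.getVert_injOn (by simp; omega) (by simp; omega) he
        omega
  simpa using key p.length le_rfl (by simp)

/-- A shortest path avoiding `S` has no collider, since morality would supply a chord that shortens
it. -/
theorem IsMoral.exists_isActive_of_reachable {D : DAG V} (hD : D.IsMoral) {S : Set V} {a b : V}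
    (h : (D.skeleton.avoiding S).Reachable a b) :
    ∃ p : D.skeleton.Walk a b, p.IsPath ∧ D.IsActive p S := by
  obtain ⟨p, hp⟩ := h.exists_walk_length_eq_dist
  have hpath := p.isPath_of_length_eq_dist hp
  have hle := D.skeleton.avoiding_le S
  refine ⟨p.mapLe hle, hpath.mapLe hle, fun i hi0 hi => ?_⟩
  have hg : ∀ j, (p.mapLe hle).getVert j = p.getVert j := fun j => by
    simp [SimpleGraph.Walk.mapLe]
  have hi' : i < p.length := by simpa [SimpleGraph.Walk.mapLe] using hi
  refine ⟨fun hc => ?_, fun _ => ?_⟩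
  · exfalso
    obtain ⟨h1, h2⟩ := hc
    rw [hg, hg] at h1 h2
    have hne : p.getVert (i - 1) ≠ p.getVert (i + 1) := fun he => by
      have := hpath.getVert_injOn (by simp; omega) (by simp; omega) he
      omega
    have e1 : (D.skeleton.avoiding S).Adj (p.getVert (i - 1)) (p.getVert (i - 1 + 1)) :=
      p.adj_getVert_succ (by omega)
    have e2 : (D.skeleton.avoiding S).Adj (p.getVert i) (p.getVert (i + 1)) :=
      p.adj_getVert_succ hi'
    have e : (D.skeleton.avoiding S).Adj (p.getVert (i - 1)) (p.getVert (i + 1)) :=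
      ⟨hD h1 h2 hne, e1.2.1, e2.2.2⟩
    have := SimpleGraph.dist_le ((p.take (i - 1)).append (.cons e (p.drop (i + 1))))
    rw [← hp] at this
    simp at this
    omega
  · rw [hg]
    exact (p.adj_getVert_succ hi').2.1

theorem IsMoral.dSeparates_iff {D : DAG V} (hD : D.IsMoral) {A B S : Set V}
    (hA : Disjoint A S) (hB : Disjoint B S) :
    D.DSeparates A B S ↔ ∀ a ∈ A, ∀ b ∈ B, ¬ (D.skeleton.avoiding S).Reachable a b := by
  refine forall₂_congr fun a ha => forall₂_congr fun b hb => ⟨fun h hr => ?_, fun h p hp hact => ?_⟩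
  · obtain ⟨p, hp, hact⟩ := hD.exists_isActive_of_reachable hr
    exact h p hp hact
  · exact h (hD.reachable_of_isActive (hA.notMem_of_mem_left ha) (hB.notMem_of_mem_left hb)
      p hp hact)

theorem IsMoral.markovEquivalent {D D' : DAG V} (hD : D.IsMoral) (hD' : D'.IsMoral)
    (h : D.skeleton = D'.skeleton) : D.MarkovEquivalent D' := by
  intro A B S _ hA hB
  rw [hD.dSeparates_iff hA hB, hD'.dSeparates_iff hA hB, h]

/-! ## Markov equivalent DAGs have the same skeleton and the same v-structures -/

theorem MarkovEquivalent.symm {D D' : DAG V} (h : D.MarkovEquivalent D') :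
    D'.MarkovEquivalent D := fun A B S h1 h2 h3 => (h A B S h1 h2 h3).symm

theorem MarkovEquivalent.refl (D : DAG V) : D.MarkovEquivalent D := fun _ _ _ _ _ _ => Iff.rfl

theorem not_dSeparates_of_adj (D : DAG V) {a b : V} (h : D.skeleton.Adj a b) (S : Set V) :
    ¬ D.DSeparates {a} {b} S := by
  intro hs
  refine hs a rfl b rfl h.toWalk (SimpleGraph.Walk.IsPath.of_adj h) fun i h0 h1 => ?_
  simp at h1
  omega

/-- The parents of a vertex d-separate it from each non-adjacent non-descendant. -/
theorem dSeparates_parents (D : DAG V) {a b : V} (hab : ¬ D.skeleton.Adj a b) (hne : a ≠ b)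
    (hd : ¬ Relation.TransGen D.Adj a b) : D.DSeparates {a} {b} {x | D.Adj x a} := by
  rintro _ rfl _ rfl p hp hact
  rename_i a b
  have hlen : 2 ≤ p.length := by
    rcases p with _ | ⟨h, _ | ⟨h', q⟩⟩
    · exact absurd rfl hne
    · exact absurd h hab
    · simp
  -- An active path must leave `a` along arrows throughout: a parent of `a` as second vertex would
  -- be a non-collider in the conditioning set, and a later reversal would be a collider with a
  -- parent of `a` among its descendants, closing a cycle.
  have key : ∀ i, i < p.length →
      Relation.ReflTransGen D.Adj a (p.getVert i) ∧ D.Adj (p.getVert i) (p.getVert (i + 1)) := by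
    intro i
    induction i with
    | zero =>
      intro _
      refine ⟨by simp [Relation.ReflTransGen.refl], ?_⟩
      rcases D.skeleton_adj.1 (p.adj_getVert_succ (i := 0) (by omega)) with h | h
      · exact h
      · exfalso
        refine (hact 1 one_pos (by omega)).2 (fun hc => ?_) (by simpa using h)
        exact D.adj_asymm hc.1 h
    | succ i ih =>
      intro hi
      obtain ⟨h1, h2⟩ := ih (by omega)
      refine ⟨h1.tail h2, ?_⟩
      rcases D.skeleton_adj.1 (p.adj_getVert_succ hi) with h | h
      · exact h
      · exfalso
        obtain ⟨s, hs, hs'⟩ := (hact (i + 1) (by omega) hi).1 ⟨h2, h⟩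
        exact D.acyclic a (Relation.TransGen.tail' ((h1.tail h2).trans hs') hs)
  obtain ⟨h1, h2⟩ := key (p.length - 1) (by omega)
  rw [Nat.sub_add_cancel (by omega), p.getVert_length] at h2
  exact hd (Relation.TransGen.tail' h1 h2)

theorem exists_dSeparates (D : DAG V) {a b : V} (hab : ¬ D.skeleton.Adj a b) (hne : a ≠ b) :
    ∃ S : Set V, a ∉ S ∧ b ∉ S ∧ (D.DSeparates {a} {b} S ∨ D.DSeparates {b} {a} S) := by
  by_cases hd : Relation.TransGen D.Adj a b
  · refine ⟨{x | D.Adj x b}, fun h => hab (D.skeleton_adj.2 (.inl h)), D.not_adj_self b, .inr ?_⟩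
    exact D.dSeparates_parents (fun h => hab h.symm) hne.symm
      fun h => D.acyclic a (hd.trans h)
  · exact ⟨{x | D.Adj x a}, D.not_adj_self a, fun h => hab (D.skeleton_adj.2 (.inr h)),
      .inl (D.dSeparates_parents hab hne hd)⟩

theorem MarkovEquivalent.skeleton_le {D D' : DAG V} (h : D.MarkovEquivalent D') :
    D.skeleton ≤ D'.skeleton := by
  intro a b hab
  by_contra hab'
  obtain ⟨S, ha, hb, hS⟩ := D'.exists_dSeparates hab' hab.ne
  rcases hS with hS | hS
  · exact D.not_dSeparates_of_adj hab S ((h _ _ _ (by simpa using hab.ne) (by simpa using ha)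
      (by simpa using hb)).2 hS)
  · exact D.not_dSeparates_of_adj hab.symm S ((h _ _ _ (by simpa using hab.ne.symm)
      (by simpa using hb) (by simpa using ha)).2 hS)

theorem MarkovEquivalent.skeleton_eq {D D' : DAG V} (h : D.MarkovEquivalent D') :
    D.skeleton = D'.skeleton := le_antisymm h.skeleton_le h.symm.skeleton_le

theorem exists_walk_isActive_iff (D : DAG V) {a b c : V} (hac : D.skeleton.Adj a c)
    (hcb : D.skeleton.Adj c b) (hne : a ≠ b) :
    ∃ p : D.skeleton.Walk a b, p.IsPath ∧ ∀ S : Set V, (D.IsActive p S ↔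
      (D.Adj a c ∧ D.Adj b c → ∃ s ∈ S, Relation.ReflTransGen D.Adj c s) ∧
      (¬ (D.Adj a c ∧ D.Adj b c) → c ∉ S)) := by
  refine ⟨.cons hac (.cons hcb .nil), ?_, fun S => ?_⟩
  · simp [hac.ne, hcb.ne, hne]
  · constructor
    · intro h
      simpa [IsCollider] using h 1 one_pos (by simp)
    · intro h i h0 h1
      obtain rfl : i = 1 := by simp at h1; omega
      simpa [IsCollider] using h

/-- Let `S` separate `a` from `b` in both DAGs. The collider `c` in `D` forces `c ∉ S`; if `c` were
not a collider in `D'`, then `c ∉ S` would leave the path through `c` active there. -/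
theorem MarkovEquivalent.adj_of_vStructure {D D' : DAG V} (h : D.MarkovEquivalent D') {a b c : V}
    (hac : D.Adj a c) (hbc : D.Adj b c) (hne : a ≠ b) (hab : ¬ D.skeleton.Adj a b) :
    D'.Adj a c := by
  have hsk := h.skeleton_eq
  have main : ∀ a b : V, D.Adj a c → D.Adj b c → a ≠ b → ∀ S : Set V, a ∉ S → b ∉ S →
      D'.DSeparates {a} {b} S → D'.Adj a c ∧ D'.Adj b c := by
    intro a b hac hbc hne S ha hb hS
    have hS' := (h _ _ _ (by simpa using hne) (by simpa using ha) (by simpa using hb)).2 hS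
    by_contra hc
    have e1 : D.skeleton.Adj a c := D.skeleton_adj.2 (.inl hac)
    have e2 : D.skeleton.Adj c b := D.skeleton_adj.2 (.inr hbc)
    obtain ⟨p, hp, hact⟩ := D.exists_walk_isActive_iff e1 e2 hne
    have hcS : c ∉ S := fun hcS => hS' a rfl b rfl p hp
      ((hact S).2 ⟨fun _ => ⟨c, hcS, .refl⟩, fun h => absurd ⟨hac, hbc⟩ h⟩)
    rw [hsk] at e1 e2
    obtain ⟨p, hp, hact⟩ := D'.exists_walk_isActive_iff e1 e2 hne
    exact hS a rfl b rfl p hp ((hact S).2 ⟨fun h => absurd h hc, fun _ => hcS⟩)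
  obtain ⟨S, ha, hb, hS | hS⟩ := D'.exists_dSeparates (hsk ▸ hab) hne
  · exact (main a b hac hbc hne S ha hb hS).1
  · exact (main b a hbc hac hne.symm S hb ha hS).2

end DAG

/-! ## Essential graphs without directed edges -/

namespace DAG

variable {V : Type*}

theorem exists_sink [Finite V] (D : DAG V) {s : Finset V} (hs : s.Nonempty) :
    ∃ v ∈ s, ∀ u ∈ s, ¬ D.Adj v u := by
  have : IsTrans V (Function.swap (Relation.TransGen D.Adj)) :=
    ⟨fun _ _ _ h1 h2 => Relation.TransGen.trans h2 h1⟩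
  have : Std.Irrefl (Function.swap (Relation.TransGen D.Adj)) := ⟨D.acyclic⟩
  have hwf := Finite.wellFounded_of_trans_of_irrefl (Function.swap (Relation.TransGen D.Adj))
  obtain ⟨v, hv, h⟩ := hwf.has_min (s : Set V) hs
  exact ⟨v, hv, fun u hu huv => h u hu (.single huv)⟩

/-- The vertices of a moral DAG can be ranked such that any two lower-ranked neighbours of a
vertex are adjacent, and such that a given clique comes first. -/
theorem IsMoral.exists_rank [Finite V] {D : DAG V} (hD : D.IsMoral) (s : Finset V) :
    ∀ Q ⊆ s, (∀ x ∈ Q, ∀ y ∈ Q, x ≠ y → D.skeleton.Adj x y) →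
    ∃ r : V → ℕ, Set.InjOn r s ∧
      (∀ u ∈ s, ∀ v ∈ s, ∀ w ∈ s, D.skeleton.Adj u w → D.skeleton.Adj v w → r u < r w →
        r v < r w → u ≠ v → D.skeleton.Adj u v) ∧
      ∀ x ∈ Q, ∀ y ∈ s, y ∉ Q → r x < r y := by
  classical
  induction s using Finset.strongInduction with
  | _ s ih =>
  intro Q hQs hQ
  rcases s.eq_empty_or_nonempty with rfl | hs
  · exact ⟨fun _ => 0, by simp, by simp, by simp⟩
  obtain ⟨v, hv, hsink⟩ := D.exists_sink hs
  have hpa : ∀ x ∈ s, D.skeleton.Adj x v → D.Adj x v := fun x hx h =>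
    (D.skeleton_adj.1 h).resolve_right (hsink x hx)
  have hcl : ∀ x ∈ s, ∀ y ∈ s, D.skeleton.Adj x v → D.skeleton.Adj y v → x ≠ y →
      D.skeleton.Adj x y := fun x hx y hy h1 h2 => hD (hpa x hx h1) (hpa y hy h2)
  by_cases hvQ : v ∈ Q
  -- The sink `v` cannot go last here. Rank the rest with the clique of neighbours of `v` first;
  -- this clique contains the rest of `Q`.
  · obtain ⟨r, hr1, hr2, hr3⟩ := ih _ (Finset.erase_ssubset hv)
      ((s.erase v).filter fun x => D.skeleton.Adj x v) (Finset.filter_subset _ _) (by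
        intro x hx y hy hne
        simp only [Finset.mem_filter, Finset.mem_erase] at hx hy
        exact hcl x hx.1.2 y hy.1.2 hx.2 hy.2 hne)
    replace hr1 : ∀ x ∈ s, x ≠ v → ∀ y ∈ s, y ≠ v → r x = r y → x = y :=
      fun x hx hxv y hy hyv h => hr1 (by simp [hx, hxv]) (by simp [hy, hyv]) h
    obtain ⟨M, hM⟩ : ∃ M, ∀ x ∈ s, r x ≤ M := ⟨s.sup r, fun x hx => Finset.le_sup hx⟩
    simp only [Finset.mem_filter, Finset.mem_erase] at hr2 hr3
    have hQv : ∀ x ∈ Q, x ≠ v → D.skeleton.Adj x v := fun x hx hne => hQ x hx v hvQ hne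
    have e1 : ∀ x ∈ Q, x ≠ v → (if x = v then M + 1 else if x ∈ Q then r x else M + 2 + r x) = r x :=
      fun x hx hne => by simp [hx, hne]
    have e2 : ∀ x ∉ Q, (if x = v then M + 1 else if x ∈ Q then r x else M + 2 + r x) =
      M + 2 + r x := fun x hx => by
        have : x ≠ v := fun h => hx (h ▸ hvQ)
        simp [hx, this]
    -- New order: the rest of `Q`, then `v`, then all others. If a later `w` is adjacent to `v`, its
    -- earlier neighbours lie in the clique formed by `v` and its neighbours; if not, they already
    -- preceded `w` under `r`.
    refine ⟨fun x => if x = v then M + 1 else if x ∈ Q then r x else M + 2 + r x, ?_, ?_, ?_⟩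
    · intro x hx y hy hxy
      have hx' := hM x hx
      have hy' := hM y hy
      grind
    · intro x hx y hy z hz hxz hyz h1 h2 hne
      have hx' := hM x hx
      have hy' := hM y hy
      have hz' := hM z hz
      have hxv := hcl x hx y hy
      grind [SimpleGraph.Adj.symm]
    · intro x hx y hy hyQ
      have hx' := hM x (hQs hx)
      grind
  · obtain ⟨r, hr1, hr2, hr3⟩ := ih _ (Finset.erase_ssubset hv) Q
      (fun x hx => Finset.mem_erase.2 ⟨fun h => hvQ (h ▸ hx), hQs hx⟩) hQ
    replace hr1 : ∀ x ∈ s, x ≠ v → ∀ y ∈ s, y ≠ v → r x = r y → x = y :=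
      fun x hx hxv y hy hyv h => hr1 (by simp [hx, hxv]) (by simp [hy, hyv]) h
    obtain ⟨M, hM⟩ : ∃ M, ∀ x ∈ s, r x ≤ M := ⟨s.sup r, fun x hx => Finset.le_sup hx⟩
    simp only [Finset.mem_erase] at hr2 hr3
    -- The sink goes last: its neighbours in `s` are all parents, hence a clique.
    refine ⟨fun x => if x = v then M + 1 else r x, ?_, ?_, ?_⟩
    · intro x hx y hy hxy
      have hx' := hM x hx
      have hy' := hM y hy
      grind
    · intro x hx y hy z hz hxz hyz h1 h2 hne
      have hx' := hM x hx
      have hy' := hM y hy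
      have hz' := hM z hz
      have hxv := hcl x hx y hy
      grind
    · intro x hx y hy hyQ
      have hx' := hM x (hQs hx)
      grind

theorem not_transGen_of_rank {R : V → V → Prop} {α : Type*} [Preorder α] (r : V → α)
    (h : ∀ a b, R a b → r a < r b) (v : V) : ¬ Relation.TransGen R v v := fun hv => by
  have : ∀ b, Relation.TransGen R v b → r v < r b := fun b hb => by
    induction hb with
    | single h' => exact h _ _ h'
    | tail _ h' ih => exact ih.trans (h _ _ h')
  exact lt_irrefl _ (this v hv)

/-- The orientation of a graph along a ranking of its vertices. -/
def ofRank (G : SimpleGraph V) (r : V → ℕ) : DAG V where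
  Adj a b := G.Adj a b ∧ r a < r b
  acyclic := not_transGen_of_rank r fun _ _ h => h.2

theorem skeleton_ofRank (G : SimpleGraph V) {r : V → ℕ} (hr : r.Injective) :
    (ofRank G r).skeleton = G := by
  ext a b
  rw [skeleton_adj]
  constructor
  · rintro (h | h)
    exacts [h.1, h.1.symm]
  · intro h
    rcases lt_or_gt_of_ne (hr.ne h.ne) with h' | h'
    exacts [.inl ⟨h, h'⟩, .inr ⟨h.symm, h'⟩]

/-- Every edge of a moral DAG is reversed in some moral DAG with the same skeleton. -/
theorem IsMoral.exists_adj_symm [Finite V] {D : DAG V} (hD : D.IsMoral) {a b : V}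
    (h : D.Adj a b) : ∃ D' : DAG V, D'.IsMoral ∧ D.skeleton = D'.skeleton ∧ D'.Adj b a := by
  have := Fintype.ofFinite V
  obtain ⟨r, hr1, hr2, hr3⟩ := hD.exists_rank Finset.univ {b} (Finset.subset_univ _) (by
    intro x hx y hy hne
    simp only [Finset.mem_singleton] at hx hy
    exact absurd (hx.trans hy.symm) hne)
  have hinj : r.Injective := fun x y hxy => hr1 (by simp) (by simp) hxy
  have hsk := skeleton_ofRank D.skeleton hinj
  have hab := D.skeleton_adj.2 (.inl h)
  refine ⟨ofRank D.skeleton r, fun x y z hx hy hne => ?_, hsk.symm, hab.symm,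
    hr3 b (by simp) a (by simp) (by simpa using hab.ne)⟩
  rw [hsk]
  exact hr2 x (by simp) y (by simp) z (by simp) hx.1 hy.1 hx.2 hy.2 hne

theorem essentialGraph_eq_toMixedGraph_iff [Finite V] (D : DAG V) (G : SimpleGraph V) :
    D.essentialGraph = G.toMixedGraph ↔ D.skeleton = G ∧ D.IsMoral := by
  constructor
  · intro h
    have harrow : ∀ a b, ¬ ∀ D' : DAG V, D.MarkovEquivalent D' → D'.Adj a b := fun a b h' => by
      have := congrFun (congrFun (congrArg MixedGraph.Arrow h) a) b
      exact this.mp h'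
    refine ⟨?_, fun a b c hac hbc hne => ?_⟩
    · ext a b
      have := congrFun (congrFun (congrArg MixedGraph.Line h) a) b
      exact ⟨fun hab => this.mp ⟨hab, harrow a b, harrow b a⟩, fun hab => (this.mpr hab).1⟩
    · by_contra hab
      exact harrow a c fun D' hD' => hD'.adj_of_vStructure hac hbc hne hab
  · rintro ⟨rfl, hD⟩
    have harrow : ∀ a b, ¬ ∀ D' : DAG V, D.MarkovEquivalent D' → D'.Adj a b := fun a b h => by
      obtain ⟨D', hD', hsk, hba⟩ := hD.exists_adj_symm (h D (.refl D))
      exact D'.adj_asymm hba (h D' (hD.markovEquivalent hD' hsk))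
    ext a b
    · exact ⟨fun h => h.1, fun h => ⟨h, harrow a b, harrow b a⟩⟩
    · exact ⟨fun h => harrow a b h, fun h => h.elim⟩

end DAG

/-- The acyclic orientations of `G` in which any two parents of a vertex are adjacent. -/
def SimpleGraph.moralOrientations {V : Type*} (G : SimpleGraph V) : Set (DAG V) :=
  {D | D.skeleton = G ∧ D.IsMoral}

theorem SimpleGraph.size_toMixedGraph {V : Type*} [Finite V] (G : SimpleGraph V) :
    G.toMixedGraph.size = G.moralOrientations.ncard := by
  rw [MixedGraph.size]
  congr 1
  ext D
  exact D.essentialGraph_eq_toMixedGraph_iff G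

/-! ## Moral orientations of extended graphs -/

section ExtendedGraph

variable {V : Type*} {K : SimpleGraph V} {m : ℕ}

@[simp] theorem extendedGraph_adj_inl_inl {u v : V} :
    (extendedGraph K m).Adj (.inl u) (.inl v) ↔ K.Adj u v := by
  simp [extendedGraph]

@[simp] theorem extendedGraph_adj_inl_inr {u : V} {i : Fin m} :
    (extendedGraph K m).Adj (.inl u) (.inr i) := by
  simp [extendedGraph]

@[simp] theorem extendedGraph_adj_inr_inl {u : V} {i : Fin m} :
    (extendedGraph K m).Adj (.inr i) (.inl u) := by
  simp [extendedGraph]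

@[simp] theorem extendedGraph_adj_inr_inr {i j : Fin m} :
    (extendedGraph K m).Adj (.inr i) (.inr j) ↔ i ≠ j := by
  simp [extendedGraph]

theorem extendedGraph_adj_inr {j : Fin m} {x : V ⊕ Fin m} (h : x ≠ .inr j) :
    (extendedGraph K m).Adj (.inr j) x := by
  rcases x with v | i
  · simp
  · simpa [eq_comm] using h

/-- A vertex placement consists of a moral orientation of `K` and, for each vertex of `K`, its
position among `m` linearly ordered dominating vertices. The positions increase along arrows, and
two vertices which are not at the last position are adjacent. -/
def placements (K : SimpleGraph V) (m : ℕ) : Set (DAG V × (V → Fin (m + 1))) :=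
  {x | x.1 ∈ K.moralOrientations ∧ (∀ u v, x.1.Adj u v → x.2 u ≤ x.2 v) ∧
    ∀ u v, u ≠ v → x.2 u ≠ Fin.last m → x.2 v ≠ Fin.last m → K.Adj u v}

/-- The arrows of the orientation of an extended graph in which the dominating vertices are
ordered by `σ` and a vertex `v` of the original graph is preceded by the first `p v` of them. -/
def insertAdj (D : DAG V) (p : V → Fin (m + 1)) (σ : Equiv.Perm (Fin m)) :
    V ⊕ Fin m → V ⊕ Fin m → Prop
  | .inl u, .inl v => D.Adj u v
  | .inl u, .inr i => (p u : ℕ) ≤ σ i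
  | .inr i, .inl u => (σ i : ℕ) < p u
  | .inr i, .inr j => σ i < σ j

theorem insertAdj_acyclic {D : DAG V} {p : V → Fin (m + 1)} (hp : ∀ u v, D.Adj u v → p u ≤ p v)
    (σ : Equiv.Perm (Fin m)) (x : V ⊕ Fin m) : ¬ Relation.TransGen (insertAdj D p σ) x x := by
  -- Position `p` lies just before the dominating vertex of rank `p`, hence levels `2p` and `2p +
  -- 1`. A cycle must stay on one level, so it uses only arrows of `D`.
  let l : V ⊕ Fin m → ℕ := Sum.elim (fun v => 2 * (p v : ℕ)) (fun i => 2 * (σ i : ℕ) + 1)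
  have hstep : ∀ x y, insertAdj D p σ x y →
      l x < l y ∨ (l x ≤ l y ∧ ∃ u v, x = .inl u ∧ y = .inl v ∧ D.Adj u v) := by
    rintro (u | i) (v | j) h
    · have := Fin.le_def.1 (hp u v h)
      exact .inr ⟨by simpa [l] using this, u, v, rfl, rfl, h⟩
    · have h : (p u : ℕ) ≤ σ j := h
      left; simp only [l, Sum.elim_inl, Sum.elim_inr]; omega
    · have h : (σ i : ℕ) < p v := h
      left; simp only [l, Sum.elim_inl, Sum.elim_inr]; omega
    · have h : σ i < σ j := h
      rw [Fin.lt_def] at h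
      left; simp only [l, Sum.elim_inr]; omega
  have key : ∀ y, Relation.TransGen (insertAdj D p σ) x y →
      l x < l y ∨ (l x ≤ l y ∧ ∃ u v, x = .inl u ∧ y = .inl v ∧ Relation.TransGen D.Adj u v) := by
    intro y hy
    induction hy with
    | single h =>
      rcases hstep _ _ h with h | ⟨h, u, v, hu, hv, huv⟩
      · exact .inl h
      · exact .inr ⟨h, u, v, hu, hv, .single huv⟩
    | tail _ h ih =>
      rcases hstep _ _ h with h | ⟨h, u, v, hu, hv, huv⟩
      · left
        rcases ih with ih | ih
        · exact ih.trans h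
        · exact ih.1.trans_lt h
      · rcases ih with ih | ⟨ih, u', v', hu', hv', huv'⟩
        · exact .inl (ih.trans_le h)
        · obtain rfl : v' = u := Sum.inl_injective (hv'.symm.trans hu)
          exact .inr ⟨ih.trans h, u', v, hu', hv, huv'.tail huv⟩
  intro hx
  rcases key x hx with h | ⟨_, u, v, rfl, hv, huv⟩
  · exact lt_irrefl _ h
  · obtain rfl := Sum.inl_injective hv
    exact D.acyclic _ huv

/-- The orientation of an extended graph given by a vertex placement and an ordering of the
dominating vertices. -/
def insertDAG (x : placements K m) (σ : Equiv.Perm (Fin m)) : DAG (V ⊕ Fin m) where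
  Adj := insertAdj x.1.1 x.1.2 σ
  acyclic := insertAdj_acyclic x.2.2.1 σ

theorem insertDAG_mem (x : placements K m) (σ : Equiv.Perm (Fin m)) :
    insertDAG x σ ∈ (extendedGraph K m).moralOrientations := by
  obtain ⟨⟨D, p⟩, ⟨hsk, hD⟩, hp, hcl⟩ := x
  dsimp only at hsk hD hp hcl
  have hsk' : (insertDAG ⟨⟨D, p⟩, ⟨hsk, hD⟩, hp, hcl⟩ σ).skeleton = extendedGraph K m := by
    ext x y
    rw [DAG.skeleton_adj]
    rcases x with u | i <;> rcases y with v | j <;> simp only [insertDAG, insertAdj]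
    · rw [← DAG.skeleton_adj, hsk, extendedGraph_adj_inl_inl]
    · simpa using le_or_gt _ _
    · simpa using lt_or_ge _ _
    · simp
  refine ⟨hsk', fun x y z hx hy hne => ?_⟩
  rw [hsk']
  rcases x with u | i
  · rcases y with v | j
    · have hne : u ≠ v := fun h => hne (congrArg _ h)
      rw [extendedGraph_adj_inl_inl]
      rcases z with w | k
      · exact hsk ▸ hD hx hy hne
      · have hx : (p u : ℕ) ≤ σ k := hx
        have hy : (p v : ℕ) ≤ σ k := hy
        refine hcl u v hne ?_ ?_ <;> rw [Ne, Fin.ext_iff, Fin.val_last] <;> omega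
    · simp
  · exact extendedGraph_adj_inr hne.symm

theorem card_filter_perm_lt (σ : Equiv.Perm (Fin m)) {n : ℕ} (hn : n ≤ m) :
    (Finset.univ.filter fun j => (σ j : ℕ) < n).card = n := by
  have : (Finset.univ.filter fun j => (σ j : ℕ) < n).card =
      (Finset.univ.filter fun j : Fin m => (j : ℕ) < n).card :=
    Finset.card_equiv σ (by simp)
  rw [this, Fin.card_filter_val_lt]
  omega

/-- Both `p v` and `σ j` are recovered as numbers of dominating parents. -/
theorem insertDAG_injective : Function.Injective
    fun x : placements K m × Equiv.Perm (Fin m) => insertDAG x.1 x.2 := by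
  rintro ⟨⟨⟨D, p⟩, hx⟩, σ⟩ ⟨⟨⟨D', p'⟩, hx'⟩, σ'⟩ h
  have h : ∀ x y, insertAdj D p σ x y ↔ insertAdj D' p' σ' x y := fun x y => by
    have := congrArg DAG.toDigraph h
    exact iff_of_eq (congrFun (congrFun (congrArg Digraph.Adj this) x) y)
  obtain rfl : D = D' := by
    ext u v
    exact h (.inl u) (.inl v)
  obtain rfl : p = p' := by
    ext v
    rw [← card_filter_perm_lt σ (n := p v) (by omega),
      ← card_filter_perm_lt σ' (n := p' v) (by omega)]
    congr 1
    ext i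
    simpa [insertAdj] using h (.inr i) (.inl v)
  obtain rfl : σ = σ' := by
    ext j
    rw [← card_filter_perm_lt σ (n := σ j) (by omega),
      ← card_filter_perm_lt σ' (n := σ' j) (by omega)]
    congr 1
    ext i
    simpa [insertAdj] using h (.inr i) (.inr j)
  rfl

-- By acyclicity, an arrow from `i` to `x` makes every dominating parent of `i` a parent of `x`,
-- with `i` itself as an extra one. Without that arrow the inclusion goes the other way.
open Classical in
theorem adj_inr_iff_card_lt {D : DAG (V ⊕ Fin m)} (hD : D.skeleton = extendedGraph K m)
    (i : Fin m) (x : V ⊕ Fin m) :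
    D.Adj (.inr i) x ↔ (Finset.univ.filter fun j => D.Adj (.inr j) (.inr i)).card <
      (Finset.univ.filter fun j => D.Adj (.inr j) x).card := by
  have htot : ∀ (j : Fin m) y, y ≠ .inr j → D.Adj (.inr j) y ∨ D.Adj y (.inr j) := fun j y hy =>
    D.skeleton_adj.1 (hD ▸ extendedGraph_adj_inr hy)
  have h3 : ∀ {a b c}, D.Adj a b → D.Adj b c → ¬ D.Adj c a := fun h1 h2 h =>
    D.acyclic _ (.tail (.tail (.single h1) h2) h)
  constructor
  · intro h
    apply Finset.card_lt_card
    rw [Finset.ssubset_iff_of_subset]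
    · exact ⟨i, by simpa using h, by simpa using D.not_adj_self _⟩
    · intro j hj
      simp only [Finset.mem_filter, Finset.mem_univ, true_and] at hj ⊢
      refine (htot j x ?_).resolve_right (h3 hj h)
      rintro rfl
      exact D.adj_asymm hj h
  · contrapose!
    intro h
    apply Finset.card_le_card
    intro j hj
    simp only [Finset.mem_filter, Finset.mem_univ, true_and] at hj ⊢
    refine (htot i (.inr j) ?_).resolve_left fun hij => ?_
    · rintro rfl'
      exact h (rfl' ▸ hj)
    · rcases htot i x (fun hx => D.adj_asymm hij (hx ▸ hj)) with h' | h'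
      · exact h h'
      · exact h3 hij hj h'

theorem insertDAG_surjective {D : DAG (V ⊕ Fin m)}
    (hD : D ∈ (extendedGraph K m).moralOrientations) :
    ∃ x : placements K m × Equiv.Perm (Fin m), insertDAG x.1 x.2 = D := by
  classical
  obtain ⟨hsk, hm⟩ := hD
  set d : V ⊕ Fin m → ℕ := fun x => (Finset.univ.filter fun j => D.Adj (.inr j) x).card with hd
  have hadj : ∀ i x, D.Adj (.inr i) x ↔ d (.inr i) < d x := adj_inr_iff_card_lt hsk
  have hle : ∀ x, d x ≤ m := fun x => (Finset.card_le_univ _).trans (by simp)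
  have hlt : ∀ i, d (.inr i) < m := fun i => by
    refine (Finset.card_lt_univ_of_notMem (x := i) ?_).trans_le (by simp)
    simpa using D.not_adj_self _
  have hinj : Function.Injective fun i => (⟨d (.inr i), hlt i⟩ : Fin m) := by
    intro i j hij
    by_contra hne
    have hij : d (.inr i) = d (.inr j) := by simpa using hij
    have : D.skeleton.Adj (.inr i) (.inr j) := by rw [hsk]; simpa using hne
    rw [DAG.skeleton_adj, hadj, hadj] at this
    omega
  have hadj' : ∀ u i, D.Adj (.inl u) (.inr i) ↔ d (.inl u) ≤ d (.inr i) := by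
    intro u i
    rw [← not_lt, ← hadj]
    have : D.skeleton.Adj (.inl u) (.inr i) := by rw [hsk]; simp
    rw [DAG.skeleton_adj] at this
    exact ⟨fun h => D.adj_asymm h, this.resolve_right⟩
  have hac : ∀ v, ¬ Relation.TransGen (fun a b => D.Adj (.inl a) (.inl b)) v v := fun v hv =>
    D.acyclic (.inl v) (Relation.TransGen.lift Sum.inl (fun _ _ h => h) _ _ hv)
  have hsk' : ({ Adj := fun a b => D.Adj (.inl a) (.inl b), acyclic := hac } : DAG V).skeleton
      = K := by
    ext a b
    rw [← extendedGraph_adj_inl_inl (K := K) (m := m), ← hsk, DAG.skeleton_adj, DAG.skeleton_adj]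
  set σ := Equiv.ofBijective _ (Finite.injective_iff_bijective.1 hinj) with hσ
  have hσ' : ∀ i, (σ i : ℕ) = d (.inr i) := fun i => rfl
  refine ⟨⟨⟨⟨⟨_, hac⟩, fun v => ⟨d (.inl v), Nat.lt_succ_of_le (hle _)⟩⟩,
    ⟨hsk', ?_⟩, ?_, ?_⟩, σ⟩, ?_⟩
  · intro a b c ha hb hne
    rw [hsk', ← extendedGraph_adj_inl_inl (m := m), ← hsk]
    exact hm ha hb (by simpa using hne)
  · intro u v (huv : D.Adj _ _)
    change d (.inl u) ≤ d (.inl v)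
    refine Finset.card_le_card fun j hj => ?_
    simp only [Finset.mem_filter, Finset.mem_univ, true_and] at hj ⊢
    have : D.skeleton.Adj (.inr j) (.inl v) := by rw [hsk]; simp
    rw [DAG.skeleton_adj] at this
    exact this.resolve_right fun h => D.acyclic _ (.tail (.tail (.single hj) huv) h)
  · intro u v hne hu hv
    have hu' : d (.inl u) < m := lt_of_le_of_ne (hle _) fun h => hu (Fin.ext h)
    have hv' : d (.inl v) < m := lt_of_le_of_ne (hle _) fun h => hv (Fin.ext h)
    -- The last dominating vertex is a common child of `u` and `v`, so morality applies.
    obtain ⟨i, hi⟩ := σ.surjective ⟨m - 1, by omega⟩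
    have hi : d (.inr i) = m - 1 := by rw [← hσ', hi]
    rw [← extendedGraph_adj_inl_inl (m := m), ← hsk]
    exact hm ((hadj' u i).2 (by omega)) ((hadj' v i).2 (by omega)) (by simpa using hne)
  · ext x y
    rcases x with u | i <;> rcases y with v | j
    · rfl
    · exact (hadj' u j).symm
    · exact (hadj i _).symm
    · exact (hadj i _).symm

theorem sizeFormula_eq [Finite V] (K : SimpleGraph V) (m : ℕ) :
    sizeFormula K m = m ! * Nat.card (placements K m) := by
  rw [sizeFormula, SimpleGraph.size_toMixedGraph, ← Nat.card_coe_set_eq]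
  have hbij : Function.Bijective fun x : placements K m × Equiv.Perm (Fin m) =>
      (⟨insertDAG x.1 x.2, insertDAG_mem x.1 x.2⟩ : (extendedGraph K m).moralOrientations) := by
    refine ⟨fun x y h => insertDAG_injective (congrArg Subtype.val h), fun D => ?_⟩
    obtain ⟨x, hx⟩ := insertDAG_surjective D.2
    exact ⟨x, Subtype.ext hx⟩
  rw [← Nat.card_eq_of_bijective _ hbij, Nat.card_prod, Nat.card_perm, Nat.card_fin, mul_comm]

end ExtendedGraph

/-! ## Counting placements -/

/-- A monotone map is the sorted list of a multiset of size `k`. -/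
theorem card_monotone_fin_fin (k m : ℕ) :
    Nat.card {f : Fin k → Fin m // Monotone f} = m.multichoose k := by
  rw [← Nat.card_fin m, ← Sym.natCard_sym_eq_multichoose, Nat.card_fin]
  refine Nat.card_eq_of_bijective
    (fun f => ⟨(List.ofFn f.1 : Multiset (Fin m)), by simp⟩) ⟨fun f g h => ?_, fun s => ?_⟩
  · have h : (List.ofFn f.1).Perm (List.ofFn g.1) :=
      Multiset.coe_eq_coe.1 (congrArg Subtype.val h)
    exact Subtype.ext (List.ofFn_injective (h.eq_of_sortedLE
      (List.sortedLE_ofFn_iff.2 f.2) (List.sortedLE_ofFn_iff.2 g.2)))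
  · obtain ⟨s, rfl⟩ := s
    have hl : (s.sort (· ≤ ·)).length = s.card := s.length_sort _
    have hs := s.pairwise_sort (· ≤ ·)
    have he := s.sort_eq (· ≤ ·)
    generalize s.sort (· ≤ ·) = l at hl hs he
    have hof : List.ofFn (fun i => l.get (Fin.cast hl.symm i)) = l := by
      subst he
      simp
    refine ⟨⟨fun i => l.get (Fin.cast hl.symm i), ?_⟩, ?_⟩
    · rw [← List.sortedLE_ofFn_iff, hof]
      exact hs.sortedLE
    · exact Subtype.ext (by simpa only [hof] using he)

theorem card_monotone_fin (α : Type*) [LinearOrder α] [Finite α] (m : ℕ) :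
    Nat.card {f : α → Fin m // Monotone f} = m.multichoose (Nat.card α) := by
  have := Fintype.ofFinite α
  rw [← card_monotone_fin_fin]
  let e := Fintype.orderIsoFinOfCardEq α (k := Nat.card α) Nat.card_eq_fintype_card.symm
  refine Nat.card_congr ((Equiv.arrowCongr e.symm.toEquiv (Equiv.refl _)).subtypeEquiv fun f => ?_)
  refine ⟨fun h => h.comp e.monotone, fun h => ?_⟩
  have := h.comp e.symm.monotone
  simpa [Function.comp_def] using this

/-- A polynomial whose value at `m` is the number of multisets of size `k` on `m` elements. -/
theorem exists_polynomial_multichoose (k : ℕ) :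
    ∃ q : Polynomial ℚ, ∀ m : ℕ, (m.multichoose k : ℚ) = q.eval (m : ℚ) := by
  refine ⟨Polynomial.C (k ! : ℚ)⁻¹ * ascPochhammer ℚ k, fun m => ?_⟩
  have h : m.ascFactorial k = k ! * m.multichoose k := by
    rw [Nat.ascFactorial_eq_factorial_mul_choose', Nat.multichoose_eq]
  have hk : (k ! : ℚ) ≠ 0 := by exact_mod_cast k.factorial_ne_zero
  rw [Polynomial.eval_mul, Polynomial.eval_C, ← ascPochhammer_eval_cast,
    ascPochhammer_nat_eq_ascFactorial, h, Nat.cast_mul, inv_mul_cancel_left₀ hk]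

section Placements

variable {V : Type*} {K : SimpleGraph V}

theorem DAG.card_monotone_of_clique [Finite V] (D : DAG V) (C : Set V)
    (hC : ∀ u ∈ C, ∀ v ∈ C, u ≠ v → D.skeleton.Adj u v) (m : ℕ) :
    Nat.card {f : C → Fin m // ∀ u v : C, D.Adj u v → f u ≤ f v} =
      m.multichoose (Nat.card C) := by
  classical
  have htri : ∀ a b : C, a ≠ b → D.Adj a b ∨ D.Adj b a := fun a b h =>
    D.skeleton_adj.1 (hC a a.2 b b.2 (Subtype.coe_injective.ne h))
  have : IsStrictTotalOrder C (fun a b => D.Adj a b) :=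
    { trichotomous := fun a b h1 h2 => by
        by_contra h
        exact (htri a b h).elim h1 h2
      irrefl := fun a => D.not_adj_self a
      trans := fun a b c h1 h2 => by
        have hca : ¬ D.Adj c a := fun h => D.acyclic _ (.tail (.tail (.single h1) h2) h)
        refine (htri a c ?_).resolve_right hca
        rintro rfl
        exact D.adj_asymm h1 h2 }
  let _ : LinearOrder C := linearOrderOfSTO (fun a b => D.Adj a b)
  rw [← card_monotone_fin]
  refine Nat.card_congr (Equiv.subtypeEquivRight fun f => ?_)
  rw [monotone_iff_forall_lt]
  rfl

/-- Vertices outside `C` sit at the last position, so only a monotone map from `C` to `Fin m` is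
free. Parent-closedness of `C` ensures that no arrow runs from the last position to an earlier one.
-/
theorem card_placements_fiber [Finite V] (D : DAG V) (C : Set V)
    (hD : D ∈ K.moralOrientations) (hC : ∀ u ∈ C, ∀ v ∈ C, u ≠ v → K.Adj u v)
    (hanc : ∀ u v, D.Adj u v → v ∈ C → u ∈ C) (m : ℕ) :
    Nat.card {x : placements K m // (x.1.1, {v | x.1.2 v ≠ Fin.last m}) = (D, C)} =
      m.multichoose (Nat.card C) := by
  classical
  rw [← D.card_monotone_of_clique C (by rwa [hD.1])]
  symm
  have hmem : ∀ (f : C → Fin m) v,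
      (if h : v ∈ C then (f ⟨v, h⟩).castSucc else Fin.last m) ≠ Fin.last m ↔ v ∈ C := by
    intro f v
    by_cases h : v ∈ C
    · simp [h, Fin.castSucc_ne_last]
    · simp [h]
  refine Nat.card_eq_of_bijective (fun f => ⟨⟨(D, fun v => if h : v ∈ C then
    (f.1 ⟨v, h⟩).castSucc else Fin.last m), hD, ?_, ?_⟩, ?_⟩) ⟨fun f g h => ?_, ?_⟩
  · intro u v huv
    by_cases hv : v ∈ C
    · have hu := hanc u v huv hv
      simpa [hu, hv] using f.2 ⟨u, hu⟩ ⟨v, hv⟩ huv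
    · simpa [hv] using Fin.le_last _
  · intro u v hne hu hv
    exact hC u ((hmem f.1 u).1 hu) v ((hmem f.1 v).1 hv) hne
  · exact Prod.ext rfl (Set.ext fun v => hmem f.1 v)
  · ext v
    have h := congrFun (congrArg Prod.snd (congrArg Subtype.val (congrArg Subtype.val h))) v.1
    simpa using congrArg Fin.val h
  · rintro ⟨⟨⟨D', p⟩, hx⟩, h⟩
    obtain ⟨rfl, rfl⟩ := Prod.mk.inj h
    refine ⟨⟨fun v => (p v).castPred v.2, fun u v huv => ?_⟩, ?_⟩
    · simpa using hx.2.1 u v huv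
    · refine Subtype.ext (Subtype.ext (Prod.ext rfl (funext fun v => ?_)))
      by_cases hv : p v = Fin.last m <;> simp [hv]

theorem exists_polynomial_card_placements [Finite V] (K : SimpleGraph V) :
    ∃ q : Polynomial ℚ, ∀ m : ℕ, (Nat.card (placements K m) : ℚ) = q.eval (m : ℚ) := by
  classical
  have := Fintype.ofFinite (DAG V × Set V)
  have key : ∀ y : DAG V × Set V, ∃ q : Polynomial ℚ, ∀ m : ℕ,
      (Nat.card {x : placements K m // (x.1.1, {v | x.1.2 v ≠ Fin.last m}) = y} : ℚ) =
        q.eval (m : ℚ) := by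
    rintro ⟨D, C⟩
    by_cases h : D ∈ K.moralOrientations ∧ (∀ u ∈ C, ∀ v ∈ C, u ≠ v → K.Adj u v) ∧
        ∀ u v, D.Adj u v → v ∈ C → u ∈ C
    · obtain ⟨q, hq⟩ := exists_polynomial_multichoose (Nat.card C)
      refine ⟨q, fun m => ?_⟩
      rw [card_placements_fiber D C h.1 h.2.1 h.2.2, hq]
    · refine ⟨0, fun m => ?_⟩
      -- The definition of a placement makes `D` moral and `C` a parent-closed clique, so every
      -- other pair has an empty fibre.
      have : IsEmpty {x : placements K m // (x.1.1, {v | x.1.2 v ≠ Fin.last m}) = (D, C)} := by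
        refine ⟨fun x => h ?_⟩
        obtain ⟨⟨⟨D', p⟩, hD, hp, hcl⟩, hx⟩ := x
        obtain ⟨rfl, rfl⟩ := Prod.mk.inj hx
        exact ⟨hD, fun u hu v hv hne => hcl u v hne hu hv,
          fun u v huv hv hu => hv (Fin.last_le_iff.1 (hu.symm.trans_le (hp u v huv)))⟩
      rw [Nat.card_of_isEmpty]
      simp
  choose q hq using key
  refine ⟨∑ y, q y, fun m => ?_⟩
  rw [Polynomial.eval_finsetSum, ← Finset.sum_congr rfl fun y _ => hq y m, ← Nat.cast_sum,
    ← Nat.card_sigma]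
  exact congrArg _ (Nat.card_congr (Equiv.sigmaFiberEquiv _).symm)

end Placements

theorem corollary1 {V : Type*} [Finite V] (K : SimpleGraph V) (hK : IsChordalGraph K) :
    (∃ q : Polynomial ℚ, ∀ m : ℕ, (sizeFormula K m : ℚ) = (m ! : ℚ) * q.eval (m : ℚ)) ∧
    ∀ m : ℕ, m ! ∣ sizeFormula K m := by
  refine ⟨?_, fun m => ⟨_, sizeFormula_eq K m⟩⟩
  obtain ⟨q, hq⟩ := exists_polynomial_card_placements K
  exact ⟨q, fun m => by rw [sizeFormula_eq, Nat.cast_mul, hq]⟩
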